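/- Let $\mathbb K\in\{\mathbb R,\mathbb C\}$, let $X\subset\mathbb R^n$ be open, and let $\mathcal H$ be a reproducing kernel Hilbert space of $\mathbb K$-valued functions on $X$ with kernel $k\in\mathcal C^1(X\times X)$; that is, $k(x,\cdot)\in\mathcal H$ and $g(x)=\langle g,k(x,\cdot)\rangle$ for all $g\in\mathcal H$, $x\in X$, where $\langle\cdot,\cdot\rangle$ is linear in the first argument. Assume that the functions $k(x,\cdot)$, $x\in X$, are linearly independent (for pairwise distinct points). Let $f=(f_1,\dots,f_n)$ be a locally Lipschitz vector field on $X$ such that $X$ is positively invariant for $\dot y=f(y)$, and let $(\varphi_t)_{t\ge 0}$, $\varphi_t:X\to X$, be its semiflow: $\varphi_0(x)=x$, $\varphi_{t+s}(x)=\varphi_t(\varphi_s(x))$, and $t\mapsto\varphi_t(x)$ solves $\dot y=f(y)$ on $[0,\infty)$ for every $x\in X$. For $t\ge 0$ the Koopman operator is $U_tg:=g\circ\varphi_t$ with domain $D(U_t):=\{g\in\mathcal H: g\circ\varphi_t\in\mathcal H\}$, and the Perron–Frobenius operator $K_t$ is the linear operator on $\mathrm{Span}\{k(x,\cdot):x\in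 X\}$ determined by $K_tk(x,\cdot):=k(\varphi_t(x),\cdot)$. A family $(T_t)_{t\ge 0}$ of bounded linear operators on $\mathcal H$ is a strongly continuous semigroup if $T_0=\mathrm{Id}$, $T_{t+s}=T_tT_s$ for all $t,s\ge 0$, and $T_tg\to g$ as $t\searrow 0$ for every $g\in\mathcal H$. Then for every $\omega>0$ the following are equivalent: 1. $D(U_t)=\mathcal H$ for all $t\ge 0$, and $(U_t)_{t\ge 0}$ is a strongly continuous semigroup of bounded operators on $\mathcal H$ with $\|U_t\|\le e^{\omega t}$ for all $t\ge 0$. 2. There is a strongly continuous semigroup $(\bar K_t)_{t\ge 0}$ of bounded operators on $\mathcal H$ such that $\bar K_t$ extends $K_t$ and $\|\bar K_t\|\le e^{\omega t}$ for all $t\ge 0$. 3. For all $m\in\mathbb N$, $a_1,\dots,a_m\in\mathbb K$ and $x_1,\dots,x_m\in X$, $$\mathrm{Re}\sum_{i,j=1}^m\sum_{l=1}^n a_i\overline{a}_j\,f_l(x_i)\,\partial_{x_l}k(x_i,x_j)\;\le\;\omega\sum_{i,j=1}^m a_i\overline{a}_j\,k(x_i,x_j),$$ where $\partial_{x_l}k$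 is the partial derivative of $k$ with respect to the $l$-th coordinate of its first variable. -/

import Mathlib

open scoped NNReal Topology

noncomputable section

namespace KoopmanRKHS

/-- The kernel section `k(x, ·)`, i.e. the element of `H` representing the evaluation at `x`:
`⟪k(x, ·), g⟫ = g x` (Mathlib's inner product is linear in the second variable). -/
def kerSec {𝕜 : Type*} [RCLike 𝕜] {S : Type*} (H : Type*) [NormedAddCommGroup H]
    [InnerProductSpace 𝕜 H] [CompleteSpace H] [RKHS 𝕜 H S 𝕜] (x : S) : H :=
  RKHS.kerFun H x (1 : 𝕜)

theorem inner_kerSec {𝕜 : Type*} [RCLike 𝕜] {S : Type*} {H : Type*} [NormedAddCommGroup H]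
    [InnerProductSpace 𝕜 H] [CompleteSpace H] [RKHS 𝕜 H S 𝕜] (x : S) (g : H) :
    inner 𝕜 (kerSec H x) g = g x := by
  simp [kerSec]

/-- The space `H` of functions on `X ⊆ E` has kernel `k`: the function `k(x, ·)` is the kernel
section at `x`. The values of `k` outside `X × X` play no role. -/
def HasKernel {𝕜 : Type*} [RCLike 𝕜] {E : Type*} {X : Set E} (H : Type*) [NormedAddCommGroup H]
    [InnerProductSpace 𝕜 H] [CompleteSpace H] [RKHS 𝕜 H X 𝕜] (k : E → E → 𝕜) : Prop :=
  ∀ x y : X, kerSec H x y = k x y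

/-- `φ` is a semiflow on `X` whose trajectories solve `ẏ = f(y)` on `[0, ∞)`. That `φ t` maps `X`
to `X` expresses the positive invariance of `X`. -/
structure IsSemiflowOf {E : Type*} [NormedAddCommGroup E] [NormedSpace ℝ E] {X : Set E}
    (f : E → E) (φ : ℝ≥0 → X → X) : Prop where
  zero : ∀ x, φ 0 x = x
  add : ∀ t s x, φ (t + s) x = φ t (φ s x)
  solution : ∀ x : X,
    IsIntegralCurveOn (fun t : ℝ => (φ t.toNNReal x : E)) (fun _ => f) (Set.Ici 0)

/-- The Koopman operator `g ↦ g ∘ F` with domain `{g ∈ H | g ∘ F ∈ H}`. -/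
def koopman {𝕜 : Type*} [RCLike 𝕜] {S : Type*} (H : Type*) [NormedAddCommGroup H]
    [InnerProductSpace 𝕜 H] [RKHS 𝕜 H S 𝕜] (F : S → S) : H →ₗ.[𝕜] H where
  domain :=
    { carrier := {g | ∃ h : H, ∀ x, h x = g (F x)}
      zero_mem' := ⟨0, fun x => by simp⟩
      add_mem' := by
        rintro g₁ g₂ ⟨h₁, e₁⟩ ⟨h₂, e₂⟩
        exact ⟨h₁ + h₂, fun x => by simp [e₁, e₂]⟩
      smul_mem' := by
        rintro c g ⟨h, e⟩
        exact ⟨c • h, fun x => by simp [e]⟩ }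
  toFun :=
    { toFun := fun g => Classical.choose g.2
      map_add' := fun g₁ g₂ => by
        ext x
        rw [Classical.choose_spec (g₁ + g₂).2 x, RKHS.coe_add, Pi.add_apply,
          Classical.choose_spec g₁.2 x, Classical.choose_spec g₂.2 x]
        simp
      map_smul' := fun c g => by
        ext x
        rw [Classical.choose_spec (c • g).2 x, RingHom.id_apply, RKHS.coe_smul, Pi.smul_apply,
          Classical.choose_spec g.2 x]
        simp }

theorem mem_koopman_domain {𝕜 : Type*} [RCLike 𝕜] {S : Type*} {H : Type*} [NormedAddCommGroup H]
    [InnerProductSpace 𝕜 H] [RKHS 𝕜 H S 𝕜] (F : S → S) (g : H) :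
    g ∈ (koopman H F).domain ↔ ∃ h : H, ∀ x, h x = g (F x) := Iff.rfl

theorem koopman_apply {𝕜 : Type*} [RCLike 𝕜] {S : Type*} {H : Type*} [NormedAddCommGroup H]
    [InnerProductSpace 𝕜 H] [RKHS 𝕜 H S 𝕜] (F : S → S) (g : (koopman H F).domain) (x : S) :
    koopman H F g x = (g : H) (F x) :=
  Classical.choose_spec g.2 x

/-- The Perron-Frobenius operator: the linear operator with domain `Span {k(x, ·) | x}` determined
by `k(x, ·) ↦ k(F x, ·)`, which is well defined if the kernel sections are linearly independent. -/
def perronFrobenius {𝕜 : Type*} [RCLike 𝕜] {S : Type*} {H : Type*} [NormedAddCommGroup H]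
    [InnerProductSpace 𝕜 H] [CompleteSpace H] [RKHS 𝕜 H S 𝕜]
    (hli : LinearIndependent 𝕜 (fun x : S => kerSec H x)) (F : S → S) : H →ₗ.[𝕜] H where
  domain := Submodule.span 𝕜 (Set.range fun x : S => kerSec H x)
  toFun := Finsupp.linearCombination 𝕜 (fun x : S => kerSec H (F x)) ∘ₗ hli.repr

theorem perronFrobenius_kerSec {𝕜 : Type*} [RCLike 𝕜] {S : Type*} {H : Type*}
    [NormedAddCommGroup H] [InnerProductSpace 𝕜 H] [CompleteSpace H] [RKHS 𝕜 H S 𝕜]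
    (hli : LinearIndependent 𝕜 (fun x : S => kerSec H x)) (F : S → S) (x : S) :
    perronFrobenius hli F ⟨kerSec H x, Submodule.subset_span (Set.mem_range_self x)⟩ =
      kerSec H (F x) := by
  have h : hli.repr ⟨kerSec H x, Submodule.subset_span (Set.mem_range_self x)⟩ =
      Finsupp.single x 1 := hli.repr_eq_single x _ rfl
  have h' := congrArg (Finsupp.linearCombination 𝕜 (fun x : S => kerSec H (F x))) h
  exact h'.trans (by simp)

/-- Strongly continuous semigroups of bounded operators. -/
structure IsStronglyContSemigroup {𝕜 : Type*} [RCLike 𝕜] {H : Type*} [NormedAddCommGroup H]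
    [NormedSpace 𝕜 H] (T : ℝ≥0 → H →L[𝕜] H) : Prop where
  zero : T 0 = ContinuousLinearMap.id 𝕜 H
  add : ∀ t s, T (t + s) = (T t).comp (T s)
  tendsto : ∀ v, Filter.Tendsto (fun t => T t v) (𝓝 0) (𝓝 v)

/-- The partial derivative `∂_{x_l} k(x, y)` in the `l`-th coordinate of the first variable. -/
def partialFst {𝕜 : Type*} [RCLike 𝕜] {n : ℕ}
    (k : EuclideanSpace ℝ (Fin n) → EuclideanSpace ℝ (Fin n) → 𝕜) (l : Fin n)
    (x y : EuclideanSpace ℝ (Fin n)) : 𝕜 :=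
  lineDeriv ℝ (fun z => k z y) x (EuclideanSpace.single l 1)

end KoopmanRKHS

end

/-! By the reproducing property, `(T* g)(x) = ⟪T k(x, ·), g⟫`. Hence `T` sends each `k(x, ·)` to
`k(F x, ·)` exactly when `T*` is composition with `F`, so bounded Koopman operators and bounded
extensions of the Perron–Frobenius operators are adjoint to each other. Adjoints keep the norm and,
under the exponential bound, strong continuity; this gives 1 ⇔ 2.

For 2 ⇔ 3, let `N t = ‖∑ a_i k(φ_t x_i, ·)‖²`. It is a Hermitian sum of kernel values, and its
derivative is twice the left-hand side of 3 at the points `φ_t x_i`. Condition 3 along trajectories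
therefore reads `N' ≤ 2ωN`, and Grönwall's argument gives `N t ≤ exp (2ωt) N 0`. Conversely, this
bound is an equality at `t = 0`, so comparing right derivatives there returns 3. The bound on finite
sums extends `K_t` to `H` by density of the kernel sections; the semigroup law and strong continuity
need checking only on those sections. -/

namespace KoopmanRKHS

open Filter Set

/-- A bound for finite families controls all linear combinations. -/
theorem norm_linearCombination_le_of_norm_sum_le {𝕜 : Type*} [RCLike 𝕜] {S : Type*}
    {H : Type*} [NormedAddCommGroup H] [NormedSpace 𝕜 H] {v w : S → H} {C : ℝ}
    (h : ∀ (m : ℕ) (a : Fin m → 𝕜) (x : Fin m → S),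
      ‖∑ i, a i • w (x i)‖ ≤ C * ‖∑ i, a i • v (x i)‖) (c : S →₀ 𝕜) :
    ‖Finsupp.linearCombination 𝕜 w c‖ ≤ C * ‖Finsupp.linearCombination 𝕜 v c‖ := by
  obtain ⟨e⟩ : Nonempty (Fin c.support.card ≃ c.support) := ⟨c.support.equivFin.symm⟩
  have key : ∀ u : S → H, Finsupp.linearCombination 𝕜 u c =
      ∑ i, c (e i : S) • u (e i : S) := by
    intro u
    rw [Finsupp.linearCombination_apply, Finsupp.sum, ← Finset.sum_coe_sort,
      ← Equiv.sum_comp e fun y : c.support => c (y : S) • u (y : S)]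
  have := h _ (fun i => c (e i : S)) fun i => (e i : S)
  rw [key, key]
  exact this

/-! ### Duality of the two operators and extension by density -/

section Operators

variable {𝕜 : Type*} [RCLike 𝕜] {S : Type*} {H : Type*} [NormedAddCommGroup H]
  [InnerProductSpace 𝕜 H] [RKHS 𝕜 H S 𝕜]

/-- Equality with a partial map of domain `⊤` encodes both `D(U) = H` and the values of `U`. -/
theorem koopman_eq_toPMap_iff (F : S → S) (T : H →L[𝕜] H) :
    koopman H F = (T : H →ₗ[𝕜] H).toPMap ⊤ ↔ ∀ g x, T g x = g (F x) := by
  constructor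
  · intro h g x
    have hg : g ∈ (koopman H F).domain := by rw [h]; trivial
    have h1 : koopman H F ⟨g, hg⟩ = T g := h.le.2 (y := ⟨g, trivial⟩) rfl
    rw [← h1, koopman_apply]
  · intro h
    refine LinearPMap.ext ?_ ?_
    · ext g
      exact ⟨fun _ => trivial, fun _ => ⟨T g, h g⟩⟩
    · intro g hg _
      refine RKHS.ext fun z => ?_
      rw [koopman_apply]
      exact (h g z).symm

variable [CompleteSpace H]

theorem perronFrobenius_le_toPMap_iff (hli : LinearIndependent 𝕜 (fun x : S => kerSec H x))
    (F : S → S) (T : H →L[𝕜] H) :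
    perronFrobenius hli F ≤ (T : H →ₗ[𝕜] H).toPMap ⊤ ↔
      ∀ x, T (kerSec H x) = kerSec H (F x) := by
  constructor
  · intro h x
    rw [← perronFrobenius_kerSec hli F x]
    exact (h.2 (x := ⟨kerSec H x, Submodule.subset_span (mem_range_self x)⟩)
      (y := ⟨kerSec H x, trivial⟩) rfl).symm
  · intro h
    refine ⟨fun _ _ => trivial, ?_⟩
    rintro x ⟨y, hy⟩ hxy
    obtain rfl : (x : H) = y := hxy
    change Finsupp.linearCombination 𝕜 (fun x : S => kerSec H (F x)) (hli.repr x) = T x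
    conv_rhs => rw [← hli.linearCombination_repr x]
    simp [Finsupp.linearCombination_apply, Finsupp.sum, h]

theorem forall_apply_kerSec_iff_adjoint (F : S → S) (T : H →L[𝕜] H) :
    (∀ x, T (kerSec H x) = kerSec H (F x)) ↔
      ∀ (g : H) x, ContinuousLinearMap.adjoint T g x = g (F x) := by
  have key : ∀ (g : H) x, ContinuousLinearMap.adjoint T g x = inner 𝕜 (T (kerSec H x)) g := by
    intro g x
    rw [← inner_kerSec (𝕜 := 𝕜) x, ContinuousLinearMap.adjoint_inner_right]
  constructor
  · intro h g x
    rw [key, h, inner_kerSec]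
  · intro h x
    refine ext_inner_right 𝕜 fun g => ?_
    rw [← key, h, inner_kerSec]

theorem span_range_kerSec_topologicalClosure :
    (Submodule.span 𝕜 (range fun x : S => kerSec H x)).topologicalClosure = ⊤ := by
  rw [eq_top_iff, ← RKHS.kerFun_dense (𝕜 := 𝕜) (X := S) (V := 𝕜) H]
  refine Submodule.topologicalClosure_mono (Submodule.span_le.2 ?_)
  rintro _ ⟨x, v, rfl⟩
  have : RKHS.kerFun H x v = v • kerSec H x := by
    rw [kerSec, ← map_smul, smul_eq_mul, mul_one]
  rw [this]
  exact Submodule.smul_mem _ _ (Submodule.subset_span (mem_range_self x))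

theorem denseRange_linearCombination_kerSec :
    DenseRange (Finsupp.linearCombination 𝕜 (fun x : S => kerSec H x)) := by
  have h := span_range_kerSec_topologicalClosure (𝕜 := 𝕜) (S := S) (H := H)
  rw [← Finsupp.range_linearCombination, ← Submodule.dense_iff_topologicalClosure_eq_top] at h
  rwa [LinearMap.coe_range] at h

theorem ext_kerSec {T T' : H →L[𝕜] H} (h : ∀ x : S, T (kerSec H x) = T' (kerSec H x)) :
    T = T' := by
  refine ContinuousLinearMap.ext_on (s := range fun x : S => kerSec H x) ?_ ?_
  · exact Submodule.dense_iff_topologicalClosure_eq_top.2 span_range_kerSec_topologicalClosure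
  · rintro _ ⟨x, rfl⟩
    exact h x

/-- A uniform bound on finite combinations yields a bounded extension of `k(x, ·) ↦ k(F x, ·)`. -/
theorem exists_extension_of_norm_sum_le (F : S → S) {C : ℝ} (hC : 0 ≤ C)
    (h : ∀ (m : ℕ) (a : Fin m → 𝕜) (x : Fin m → S),
      ‖∑ i, a i • kerSec H (F (x i))‖ ≤ C * ‖∑ i, a i • kerSec H (x i)‖) :
    ∃ T : H →L[𝕜] H, (∀ x, T (kerSec H x) = kerSec H (F x)) ∧ ‖T‖ ≤ C := by
  have hb := norm_linearCombination_le_of_norm_sum_le (v := fun x => kerSec H x)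
    (w := fun x => kerSec H (F x)) h
  have hd := denseRange_linearCombination_kerSec (𝕜 := 𝕜) (S := S) (H := H)
  refine ⟨LinearMap.extendOfNorm (Finsupp.linearCombination 𝕜 fun x => kerSec H (F x))
    (Finsupp.linearCombination 𝕜 fun x => kerSec H x), fun x => ?_,
    LinearMap.opNorm_extendOfNorm_le hd hC hb⟩
  have := LinearMap.extendOfNorm_eq hd ⟨C, hb⟩ (Finsupp.single x 1)
  simpa only [Finsupp.linearCombination_single, one_smul] using this

end Operators

/-! ### Strong continuity: adjoints and dense subsets -/

section Semigroups

variable {𝕜 : Type*} [RCLike 𝕜] {H : Type*} [NormedAddCommGroup H] [InnerProductSpace 𝕜 H]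

theorem tendsto_exp_mul_nnreal (ω : ℝ) :
    Tendsto (fun t : ℝ≥0 => Real.exp (ω * t)) (𝓝 0) (𝓝 1) := by
  have : Continuous fun t : ℝ≥0 => Real.exp (ω * t) := by fun_prop
  simpa using this.tendsto 0

/-- The adjoint of an exponentially bounded strongly continuous semigroup is strongly continuous,
since weak convergence and `limsup ‖T t* v‖ ≤ ‖v‖` imply strong convergence. -/
theorem IsStronglyContSemigroup.adjoint [CompleteSpace H] {T : ℝ≥0 → H →L[𝕜] H}
    (hT : IsStronglyContSemigroup T) {ω : ℝ} (hω : ∀ t, ‖T t‖ ≤ Real.exp (ω * t)) :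
    IsStronglyContSemigroup fun t => ContinuousLinearMap.adjoint (T t) where
  zero := by
    rw [hT.zero]
    exact ContinuousLinearMap.adjoint_id
  -- Adjoints reverse composition; commutativity of time restores the order.
  add t s := by rw [add_comm, hT.add, ContinuousLinearMap.adjoint_comp]
  tendsto v := by
    rw [tendsto_iff_norm_sub_tendsto_zero]
    have hle : ∀ t, ‖ContinuousLinearMap.adjoint (T t) v - v‖ ^ 2 ≤
        (Real.exp (ω * t) * ‖v‖) ^ 2 - 2 * RCLike.re (inner 𝕜 v (T t v)) + ‖v‖ ^ 2 := by
      intro t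
      rw [norm_sub_sq (𝕜 := 𝕜), ContinuousLinearMap.adjoint_inner_left]
      gcongr
      refine (ContinuousLinearMap.le_opNorm _ _).trans ?_
      rw [LinearIsometryEquiv.norm_map]
      gcongr
      exact hω t
    have hlim : Tendsto (fun t : ℝ≥0 => (Real.exp (ω * t) * ‖v‖) ^ 2 -
        2 * RCLike.re (inner 𝕜 v (T t v)) + ‖v‖ ^ 2) (𝓝 0) (𝓝 0) := by
      have h1 : Tendsto (fun t : ℝ≥0 => RCLike.re (inner 𝕜 v (T t v))) (𝓝 0)
          (𝓝 (RCLike.re (inner 𝕜 v v))) :=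
        (RCLike.continuous_re.tendsto _).comp (tendsto_const_nhds.inner (hT.tendsto v))
      have h2 := ((((tendsto_exp_mul_nnreal ω).mul_const ‖v‖).pow 2).sub
        (h1.const_mul 2)).add_const (‖v‖ ^ 2)
      rw [inner_self_eq_norm_sq] at h2
      convert h2 using 2
      ring
    have hsq := squeeze_zero (fun t => sq_nonneg _) hle hlim
    have := (Real.continuous_sqrt.tendsto 0).comp hsq
    simpa [Function.comp_def, Real.sqrt_sq (norm_nonneg _)] using this

/-- Strong continuity at `0` of an exponentially bounded family can be checked on a set with dense
span. -/
theorem tendsto_apply_of_dense_span {T : ℝ≥0 → H →L[𝕜] H} {ω : ℝ}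
    (hω : ∀ t, ‖T t‖ ≤ Real.exp (ω * t)) {s : Set H}
    (hs : (Submodule.span 𝕜 s).topologicalClosure = ⊤)
    (h : ∀ v ∈ s, Tendsto (fun t => T t v) (𝓝 0) (𝓝 v)) (v : H) :
    Tendsto (fun t => T t v) (𝓝 0) (𝓝 v) := by
  have hspan : ∀ w ∈ Submodule.span 𝕜 s, Tendsto (fun t => T t w) (𝓝 0) (𝓝 w) := by
    intro w hw
    induction hw using Submodule.span_induction with
    | mem w hw => exact h w hw
    | zero => simp
    | add a b _ _ ha hb => simpa using ha.add hb
    | smul c a _ ha => simpa using ha.const_smul c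
  rw [Metric.tendsto_nhds]
  intro ε hε
  have hv : v ∈ closure (Submodule.span 𝕜 s : Set H) := by
    rw [← Submodule.topologicalClosure_coe, hs]; trivial
  obtain ⟨w, hw, hvw⟩ := Metric.mem_closure_iff.1 hv (ε / 4) (by positivity)
  -- For small `t` the norm bound is at most `2`, so the three distances sum to less than `2 * (ε /
  -- 4) + ε / 4 + ε / 4 = ε`.
  filter_upwards [Metric.tendsto_nhds.1 (hspan w hw) (ε / 4) (by positivity),
    (tendsto_exp_mul_nnreal ω).eventually_le_const (u := 2) (by norm_num)] with t h1 h2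
  have h3 : dist (T t v) (T t w) ≤ 2 * dist v w := by
    rw [dist_eq_norm, dist_eq_norm, ← map_sub]
    refine (ContinuousLinearMap.le_opNorm _ _).trans ?_
    gcongr
    exact (hω t).trans h2
  have h4 := dist_triangle4 (T t v) (T t w) w v
  rw [dist_comm w v] at h4
  linarith

end Semigroups

/-! ### Hermitian symmetry and norms in terms of kernel values -/

section Kernel

variable {𝕜 : Type*} [RCLike 𝕜] {E : Type*} {X : Set E} {H : Type*} [NormedAddCommGroup H]
  [InnerProductSpace 𝕜 H] [CompleteSpace H] [RKHS 𝕜 H X 𝕜] {k : E → E → 𝕜}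

theorem HasKernel.inner_kerSec_kerSec (hk : HasKernel H k) (x y : X) :
    inner 𝕜 (kerSec H y) (kerSec H x) = k x y := by
  rw [inner_kerSec, hk]

theorem HasKernel.conj_symm (hk : HasKernel H k) (x y : X) :
    starRingEnd 𝕜 (k x y) = k y x := by
  rw [← hk.inner_kerSec_kerSec, inner_conj_symm, hk.inner_kerSec_kerSec]

theorem HasKernel.norm_sum_sq (hk : HasKernel H k) {m : ℕ} (a : Fin m → 𝕜) (x : Fin m → X) :
    ‖∑ i, a i • kerSec H (x i)‖ ^ 2 =
      RCLike.re (∑ i, ∑ j, a i * starRingEnd 𝕜 (a j) * k (x i) (x j)) := by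
  rw [← inner_self_eq_norm_sq (𝕜 := 𝕜), inner_sum]
  congr 1
  refine Finset.sum_congr rfl fun i _ => ?_
  rw [sum_inner]
  refine Finset.sum_congr rfl fun j _ => ?_
  rw [inner_smul_left, inner_smul_right, hk.inner_kerSec_kerSec]
  ring

end Kernel

/-! ### Differentiation along the flow, Grönwall and its converse -/

section Flow

variable {𝕜 : Type*} [RCLike 𝕜] {n : ℕ} {X : Set (EuclideanSpace ℝ (Fin n))}
  {k : EuclideanSpace ℝ (Fin n) → EuclideanSpace ℝ (Fin n) → 𝕜}

theorem fderiv_inl_eq_sum_partialFst {x y : EuclideanSpace ℝ (Fin n)}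
    (hd : DifferentiableAt ℝ (fun p : EuclideanSpace ℝ (Fin n) × EuclideanSpace ℝ (Fin n) =>
      k p.1 p.2) (x, y)) (v : EuclideanSpace ℝ (Fin n)) :
    fderiv ℝ (fun p : EuclideanSpace ℝ (Fin n) × EuclideanSpace ℝ (Fin n) => k p.1 p.2) (x, y)
      (v, 0) = ∑ l, ((v l : ℝ) : 𝕜) * partialFst k l x y := by
  have h1 : HasFDerivAt (fun z => k z y) ((fderiv ℝ (fun p : EuclideanSpace ℝ (Fin n) ×
      EuclideanSpace ℝ (Fin n) => k p.1 p.2) (x, y)).comp (ContinuousLinearMap.inl ℝ _ _)) x :=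
    HasFDerivAt.comp (f := fun z => (z, y)) x hd.hasFDerivAt (hasFDerivAt_prodMk_left x y)
  have h2 : ∀ l, partialFst k l x y = fderiv ℝ (fun p : EuclideanSpace ℝ (Fin n) ×
      EuclideanSpace ℝ (Fin n) => k p.1 p.2) (x, y) (EuclideanSpace.single l 1, 0) := fun l =>
    (h1.hasLineDerivAt _).lineDeriv
  have h3 : v = ∑ l, v l • EuclideanSpace.single l (1 : ℝ) := by
    ext i
    simp [Finset.sum_apply, Pi.single_apply]
  have h4 : ((v, 0) : EuclideanSpace ℝ (Fin n) × EuclideanSpace ℝ (Fin n)) =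
      ∑ l, v l • (EuclideanSpace.single l (1 : ℝ), 0) := by
    conv_lhs => rw [h3]
    refine Prod.ext ?_ ?_ <;> simp [Prod.fst_sum, Prod.snd_sum]
  rw [h4, map_sum]
  refine Finset.sum_congr rfl fun l _ => ?_
  rw [map_smul, h2, RCLike.real_smul_eq_coe_mul]

variable {H : Type*} [NormedAddCommGroup H] [InnerProductSpace 𝕜 H] [CompleteSpace H]
  [RKHS 𝕜 H X 𝕜]

/-- Hermitian symmetry turns second-variable derivatives into conjugated first-variable ones. It is
known only on `X`, so openness is what allows differentiating it. -/
theorem HasKernel.fderiv_inr_eq_conj (hX : IsOpen X) (hk : HasKernel H k)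
    (hd : ∀ x y : X, DifferentiableAt ℝ (fun p : EuclideanSpace ℝ (Fin n) ×
      EuclideanSpace ℝ (Fin n) => k p.1 p.2) (x, y)) (x y : X) (v : EuclideanSpace ℝ (Fin n)) :
    fderiv ℝ (fun p : EuclideanSpace ℝ (Fin n) × EuclideanSpace ℝ (Fin n) => k p.1 p.2) (x, y)
      (0, v) = starRingEnd 𝕜 (∑ l, ((v l : ℝ) : 𝕜) * partialFst k l y x) := by
  rw [← fderiv_inl_eq_sum_partialFst (hd y x)]
  have h1 : HasFDerivAt (fun z => k x z) ((fderiv ℝ (fun p : EuclideanSpace ℝ (Fin n) ×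
      EuclideanSpace ℝ (Fin n) => k p.1 p.2) (x, y)).comp (ContinuousLinearMap.inr ℝ _ _))
      (y : EuclideanSpace ℝ (Fin n)) :=
    HasFDerivAt.comp (f := fun z => ((x : EuclideanSpace ℝ (Fin n)), z)) _ (hd x y).hasFDerivAt
      (hasFDerivAt_prodMk_right _ _)
  have h2 : HasFDerivAt (fun z => k z x) ((fderiv ℝ (fun p : EuclideanSpace ℝ (Fin n) ×
      EuclideanSpace ℝ (Fin n) => k p.1 p.2) (y, x)).comp (ContinuousLinearMap.inl ℝ _ _))
      (y : EuclideanSpace ℝ (Fin n)) :=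
    HasFDerivAt.comp (f := fun z => (z, (x : EuclideanSpace ℝ (Fin n)))) _ (hd y x).hasFDerivAt
      (hasFDerivAt_prodMk_left _ _)
  have h3 := (RCLike.conjCLE (K := 𝕜)).toContinuousLinearMap.hasFDerivAt.comp
    (y : EuclideanSpace ℝ (Fin n)) h2
  have h4 : (fun z => k x z) =ᶠ[𝓝 (y : EuclideanSpace ℝ (Fin n))]
      (RCLike.conjCLE (K := 𝕜)).toContinuousLinearMap ∘ fun z => k z x := by
    filter_upwards [hX.mem_nhds y.2] with z hz
    simpa using (hk.conj_symm ⟨z, hz⟩ x).symm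
  have h5 := h1.unique (h3.congr_of_eventuallyEq h4)
  simpa using DFunLike.congr_fun h5 v

theorem hasDerivWithinAt_kernel_comp (hX : IsOpen X) (hk : HasKernel H k)
    (hd : ∀ x y : X, DifferentiableAt ℝ (fun p : EuclideanSpace ℝ (Fin n) ×
      EuclideanSpace ℝ (Fin n) => k p.1 p.2) (x, y)) {c d : ℝ → X}
    {u v : EuclideanSpace ℝ (Fin n)} {s : Set ℝ} {t : ℝ}
    (hc : HasDerivWithinAt (fun t => (c t : EuclideanSpace ℝ (Fin n))) u s t)
    (hd' : HasDerivWithinAt (fun t => (d t : EuclideanSpace ℝ (Fin n))) v s t) :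
    HasDerivWithinAt (fun t => k (c t) (d t))
      (∑ l, ((u l : ℝ) : 𝕜) * partialFst k l (c t) (d t) +
        starRingEnd 𝕜 (∑ l, ((v l : ℝ) : 𝕜) * partialFst k l (d t) (c t))) s t := by
  have h := (hd (c t) (d t)).hasFDerivAt.comp_hasDerivWithinAt_of_eq t (hc.prodMk hd') rfl
  have h2 : ((u, v) : EuclideanSpace ℝ (Fin n) × EuclideanSpace ℝ (Fin n)) = (u, 0) + (0, v) := by
    simp
  rw [h2, map_add, fderiv_inl_eq_sum_partialFst (hd _ _), hk.fderiv_inr_eq_conj hX hd] at h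
  exact h

variable {f : EuclideanSpace ℝ (Fin n) → EuclideanSpace ℝ (Fin n)} {φ : ℝ≥0 → X → X}

theorem hasDerivWithinAt_norm_sum_sq (hX : IsOpen X) (hk : HasKernel H k)
    (hd : ∀ x y : X, DifferentiableAt ℝ (fun p : EuclideanSpace ℝ (Fin n) ×
      EuclideanSpace ℝ (Fin n) => k p.1 p.2) (x, y)) (hφ : IsSemiflowOf f φ) {m : ℕ}
    (a : Fin m → 𝕜) (x : Fin m → X) {t : ℝ} (ht : 0 ≤ t) :
    HasDerivWithinAt (fun t : ℝ => ‖∑ i, a i • kerSec H (φ t.toNNReal (x i))‖ ^ 2)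
      (2 * RCLike.re (∑ i, ∑ j, ∑ l, a i * starRingEnd 𝕜 (a j) *
        ((f (φ t.toNNReal (x i)) l : ℝ) : 𝕜) *
          partialFst k l (φ t.toNNReal (x i)) (φ t.toNNReal (x j)))) (Ici 0) t := by
  have h1 : ∀ i j, HasDerivWithinAt
      (fun t : ℝ => k (φ t.toNNReal (x i)) (φ t.toNNReal (x j))) _ (Ici 0) t := fun i j =>
    hasDerivWithinAt_kernel_comp hX hk hd (hφ.solution (x i) t ht) (hφ.solution (x j) t ht)
  have h2 := HasDerivWithinAt.fun_sum (u := Finset.univ) fun i _ =>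
    HasDerivWithinAt.fun_sum (u := Finset.univ) fun j _ =>
      (h1 i j).const_mul (a i * starRingEnd 𝕜 (a j))
  have h3 := (RCLike.reCLM (K := 𝕜)).hasFDerivAt.comp_hasDerivWithinAt t h2
  simp only [hk.norm_sum_sq]
  refine h3.congr_deriv ?_
  simp only [mul_add, Finset.sum_add_distrib, Finset.mul_sum, map_sum (starRingEnd 𝕜)]
  rw [RCLike.reCLM_apply, map_add, two_mul]
  congr 1
  · simp only [mul_assoc]
  -- Conjugating and exchanging `i` and `j` turns the second half into the first, whence the factor
  -- `2`.
  · rw [← RCLike.conj_re, Finset.sum_comm]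
    simp only [map_sum (starRingEnd 𝕜), map_mul, RCLike.conj_conj, RCLike.conj_ofReal]
    congr 1
    refine Finset.sum_congr rfl fun i _ => Finset.sum_congr rfl fun j _ =>
      Finset.sum_congr rfl fun l _ => ?_
    ring

/-- The dissipativity inequality and Grönwall's inequality bound the Perron-Frobenius operators. -/
theorem norm_sum_le_of_dissipative (hX : IsOpen X) (hk : HasKernel H k)
    (hd : ∀ x y : X, DifferentiableAt ℝ (fun p : EuclideanSpace ℝ (Fin n) ×
      EuclideanSpace ℝ (Fin n) => k p.1 p.2) (x, y)) (hφ : IsSemiflowOf f φ) {ω : ℝ}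
    (hdiss : ∀ (m : ℕ) (a : Fin m → 𝕜) (x : Fin m → X),
      RCLike.re (∑ i, ∑ j, ∑ l, a i * starRingEnd 𝕜 (a j) * ((f (x i) l : ℝ) : 𝕜) *
        partialFst k l (x i) (x j)) ≤
      ω * RCLike.re (∑ i, ∑ j, a i * starRingEnd 𝕜 (a j) * k (x i) (x j)))
    (t : ℝ≥0) {m : ℕ} (a : Fin m → 𝕜) (x : Fin m → X) :
    ‖∑ i, a i • kerSec H (φ t (x i))‖ ≤ Real.exp (ω * t) * ‖∑ i, a i • kerSec H (x i)‖ := by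
  set N : ℝ → ℝ := fun t => ‖∑ i, a i • kerSec H (φ t.toNNReal (x i))‖ ^ 2 with hN
  have hN' : ∀ t : ℝ, 0 ≤ t → ∃ N', HasDerivWithinAt N N' (Ici 0) t ∧ N' ≤ 2 * ω * N t := by
    intro t ht
    refine ⟨_, hasDerivWithinAt_norm_sum_sq hX hk hd hφ a x ht, ?_⟩
    have := hdiss m a fun i => φ t.toNNReal (x i)
    rw [← hk.norm_sum_sq] at this
    simp only [hN]
    linarith
  choose! N' hderiv hle using hN'
  -- Integrating factor: `N' ≤ 2ωN` makes `exp (-2ωt) N t` antitone.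
  have hE : ∀ t : ℝ, HasDerivAt (fun t => Real.exp (-(2 * ω) * t))
      (Real.exp (-(2 * ω) * t) * -(2 * ω)) t := fun t => by
    simpa using ((hasDerivAt_id t).const_mul (-(2 * ω))).exp
  have hG : ∀ t : ℝ, 0 ≤ t → HasDerivWithinAt (fun t => Real.exp (-(2 * ω) * t) * N t)
      (Real.exp (-(2 * ω) * t) * -(2 * ω) * N t + Real.exp (-(2 * ω) * t) * N' t) (Ici 0) t :=
    fun t ht => (hE t).hasDerivWithinAt.mul (hderiv t ht)
  have hanti : AntitoneOn (fun t => Real.exp (-(2 * ω) * t) * N t) (Ici 0) := by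
    refine antitoneOn_of_hasDerivWithinAt_nonpos (convex_Ici 0)
      (fun t ht => (hG t ht).continuousWithinAt)
      (fun t ht => (hG t (interior_subset ht)).mono interior_subset) fun t ht => ?_
    have h1 := hle t (interior_subset ht)
    have h2 := mul_le_mul_of_nonneg_left h1 (Real.exp_pos (-(2 * ω) * t)).le
    linarith
  have h0 := hanti (mem_Ici.2 le_rfl) (mem_Ici.2 t.2) t.2
  simp only [hN, Real.toNNReal_coe, Real.toNNReal_zero, hφ.zero, mul_zero, Real.exp_zero, one_mul,
    NNReal.val_eq_coe] at h0
  refine le_of_sq_le_sq ?_ (by positivity)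
  rw [mul_pow, ← Real.exp_nat_mul]
  calc ‖∑ i, a i • kerSec H (φ t (x i))‖ ^ 2
      = Real.exp (2 * (ω * t)) * (Real.exp (-(2 * ω) * t) *
        ‖∑ i, a i • kerSec H (φ t (x i))‖ ^ 2) := by
        rw [← mul_assoc, ← Real.exp_add]
        ring_nf
        simp
    _ ≤ _ := by
        push_cast
        gcongr

/-- Expanding `‖k(y, ·) - k(x, ·)‖²` leaves only kernel values, which are continuous in `y` and
cancel at `y = x`. -/
theorem continuous_kerSec (hk : HasKernel H k)
    (hc : ContinuousOn (fun p : EuclideanSpace ℝ (Fin n) × EuclideanSpace ℝ (Fin n) =>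
      k p.1 p.2) (X ×ˢ X)) : Continuous fun x : X => kerSec H x := by
  have hc' : Continuous fun p : X × X => k p.1 p.2 :=
    hc.comp_continuous (f := fun p : X × X => ((p.1 : EuclideanSpace ℝ (Fin n)),
      (p.2 : EuclideanSpace ℝ (Fin n)))) (by fun_prop) fun p => ⟨p.1.2, p.2.2⟩
  refine continuous_iff_continuousAt.2 fun x => ?_
  rw [ContinuousAt, tendsto_iff_norm_sub_tendsto_zero]
  have h1 : ∀ y : X, ‖kerSec H y - kerSec H x‖ ^ 2 =
      RCLike.re (k y y) - 2 * RCLike.re (k x y) + RCLike.re (k x x) := fun y => by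
    rw [norm_sub_sq (𝕜 := 𝕜), hk.inner_kerSec_kerSec, ← inner_self_eq_norm_sq (𝕜 := 𝕜),
      ← inner_self_eq_norm_sq (𝕜 := 𝕜), hk.inner_kerSec_kerSec, hk.inner_kerSec_kerSec]
  have h2 : Continuous fun y : X =>
      RCLike.re (k y y) - 2 * RCLike.re (k x y) + RCLike.re (k x x) := by
    have hre := RCLike.continuous_re (K := 𝕜)
    have e1 : Continuous fun y : X => k y y := hc'.comp (continuous_id.prodMk continuous_id)
    have e2 : Continuous fun y : X => k x y := hc'.comp (continuous_const.prodMk continuous_id)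
    exact ((hre.comp e1).sub (continuous_const.mul (hre.comp e2))).add continuous_const
  have h3 := (Real.continuous_sqrt.comp h2).tendsto x
  simp only [Function.comp_def, ← h1, Real.sqrt_sq (norm_nonneg _), sub_self, norm_zero] at h3
  simpa using h3

theorem IsSemiflowOf.tendsto_zero (hφ : IsSemiflowOf f φ) (x : X) :
    Tendsto (fun t => φ t x) (𝓝 0) (𝓝 x) := by
  rw [tendsto_subtype_rng]
  have h1 := (hφ.solution x 0 (mem_Ici.2 le_rfl)).continuousWithinAt.tendsto
  have h2 : Tendsto (fun t : ℝ≥0 => (t : ℝ)) (𝓝 0) (𝓝[Ici 0] 0) :=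
    tendsto_nhdsWithin_iff.2 ⟨NNReal.continuous_coe.tendsto' _ _ rfl, .of_forall fun t => t.2⟩
  simpa [Function.comp_def, hφ.zero] using h1.comp h2

/-- The growth bound forces the right derivative at `0` of `‖K_t v‖² - exp (2ωt) ‖v‖²` to be
nonpositive. -/
theorem dissipative_of_norm_sum_le (hX : IsOpen X) (hk : HasKernel H k)
    (hd : ∀ x y : X, DifferentiableAt ℝ (fun p : EuclideanSpace ℝ (Fin n) ×
      EuclideanSpace ℝ (Fin n) => k p.1 p.2) (x, y)) (hφ : IsSemiflowOf f φ) {ω : ℝ} {m : ℕ}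
    (a : Fin m → 𝕜) (x : Fin m → X)
    (h : ∀ t : ℝ≥0, ‖∑ i, a i • kerSec H (φ t (x i))‖ ≤
      Real.exp (ω * t) * ‖∑ i, a i • kerSec H (x i)‖) :
    RCLike.re (∑ i, ∑ j, ∑ l, a i * starRingEnd 𝕜 (a j) * ((f (x i) l : ℝ) : 𝕜) *
        partialFst k l (x i) (x j)) ≤
      ω * RCLike.re (∑ i, ∑ j, a i * starRingEnd 𝕜 (a j) * k (x i) (x j)) := by
  have h1 := hasDerivWithinAt_norm_sum_sq hX hk hd hφ a x le_rfl
  have hE : HasDerivAt (fun t => (Real.exp (ω * t) * ‖∑ i, a i • kerSec H (x i)‖) ^ 2)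
      (2 * (ω * ‖∑ i, a i • kerSec H (x i)‖ ^ 2)) 0 := by
    have := ((((hasDerivAt_id (0 : ℝ)).const_mul ω).exp).mul_const
      ‖∑ i, a i • kerSec H (x i)‖).fun_pow 2
    refine this.congr_deriv ?_
    simp
    ring
  have h2 := h1.sub hE.hasDerivWithinAt
  -- The difference vanishes at `0` and is nonpositive afterwards; its derivative in the inward
  -- direction `1` is thus nonpositive.
  have hmax : IsLocalMaxOn ((fun t : ℝ => ‖∑ i, a i • kerSec H (φ t.toNNReal (x i))‖ ^ 2) -
      fun t => (Real.exp (ω * t) * ‖∑ i, a i • kerSec H (x i)‖) ^ 2) (Ici 0) 0 := by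
    refine eventually_mem_nhdsWithin.mono fun t ht => ?_
    have h3 := h t.toNNReal
    rw [Real.coe_toNNReal t ht] at h3
    have h4 := pow_le_pow_left₀ (norm_nonneg _) h3 2
    simp only [Pi.sub_apply, Real.toNNReal_zero, hφ.zero, mul_zero, Real.exp_zero, one_mul,
      sub_self]
    linarith
  have h5 := hmax.hasFDerivWithinAt_nonpos h2.hasFDerivWithinAt (y := 1)
    (mem_posTangentConeAt_of_segment_subset
      ((convex_Ici 0).segment_subset (by simp) (by simp)))
  simp only [Real.toNNReal_zero, hφ.zero, ← hk.norm_sum_sq] at h5 ⊢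
  rw [ContinuousLinearMap.toSpanSingleton_apply, one_smul] at h5
  linarith

end Flow

end KoopmanRKHS

/-! ### The equivalence -/

theorem mainTheorem2 {𝕜 : Type*} [RCLike 𝕜] {n : ℕ} {X : Set (EuclideanSpace ℝ (Fin n))}
    (hX : IsOpen X)
    {H : Type*} [NormedAddCommGroup H] [InnerProductSpace 𝕜 H] [CompleteSpace H] [RKHS 𝕜 H X 𝕜]
    (k : EuclideanSpace ℝ (Fin n) → EuclideanSpace ℝ (Fin n) → 𝕜)
    (hk : KoopmanRKHS.HasKernel H k)
    (hkC1 : ContDiffOn ℝ 1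
      (fun p : EuclideanSpace ℝ (Fin n) × EuclideanSpace ℝ (Fin n) => k p.1 p.2) (X ×ˢ X))
    (hli : LinearIndependent 𝕜 (fun x : X => KoopmanRKHS.kerSec H x))
    (f : EuclideanSpace ℝ (Fin n) → EuclideanSpace ℝ (Fin n)) (hf : LocallyLipschitzOn X f)
    (φ : ℝ≥0 → X → X) (hφ : KoopmanRKHS.IsSemiflowOf f φ)
    (ω : ℝ) (hω : 0 < ω) :
    List.TFAE [
      -- the operators `U_t` are everywhere defined and form a strongly continuous semigroup
      ∃ U : ℝ≥0 → H →L[𝕜] H,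
        (∀ t, KoopmanRKHS.koopman H (φ t) = (U t : H →ₗ[𝕜] H).toPMap ⊤) ∧
        KoopmanRKHS.IsStronglyContSemigroup U ∧
        ∀ t, ‖U t‖ ≤ Real.exp (ω * t),
      -- the operators `K_t` have extensions that form a strongly continuous semigroup
      ∃ Kbar : ℝ≥0 → H →L[𝕜] H,
        (∀ t, KoopmanRKHS.perronFrobenius hli (φ t) ≤ (Kbar t : H →ₗ[𝕜] H).toPMap ⊤) ∧
        KoopmanRKHS.IsStronglyContSemigroup Kbar ∧
        ∀ t, ‖Kbar t‖ ≤ Real.exp (ω * t),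
      -- the dissipativity inequality; the sum on the right-hand side is real
      ∀ (m : ℕ) (a : Fin m → 𝕜) (x : Fin m → X),
        RCLike.re (∑ i, ∑ j, ∑ l, a i * starRingEnd 𝕜 (a j) * ((f (x i) l : ℝ) : 𝕜) *
          KoopmanRKHS.partialFst k l (x i) (x j)) ≤
        ω * RCLike.re (∑ i, ∑ j, a i * starRingEnd 𝕜 (a j) * k (x i) (x j))] := by
  have hd : ∀ x y : X, DifferentiableAt ℝ (fun p : EuclideanSpace ℝ (Fin n) ×
      EuclideanSpace ℝ (Fin n) => k p.1 p.2) (x, y) := fun x y =>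
    (hkC1.differentiableOn one_ne_zero).differentiableAt ((hX.prod hX).mem_nhds ⟨x.2, y.2⟩)
  simp only [KoopmanRKHS.koopman_eq_toPMap_iff, KoopmanRKHS.perronFrobenius_le_toPMap_iff]
  tfae_have 1 → 2 := by
    rintro ⟨U, hU, hsg, hb⟩
    refine ⟨fun t => ContinuousLinearMap.adjoint (U t), fun t => ?_, hsg.adjoint hb, fun t => ?_⟩
    · rw [KoopmanRKHS.forall_apply_kerSec_iff_adjoint, ContinuousLinearMap.adjoint_adjoint]
      exact hU t
    · rw [LinearIsometryEquiv.norm_map]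
      exact hb t
  tfae_have 2 → 1 := by
    rintro ⟨K, hK, hsg, hb⟩
    refine ⟨fun t => ContinuousLinearMap.adjoint (K t), fun t => ?_, hsg.adjoint hb, fun t => ?_⟩
    · exact (KoopmanRKHS.forall_apply_kerSec_iff_adjoint _ _).1 (hK t)
    · rw [LinearIsometryEquiv.norm_map]
      exact hb t
  tfae_have 2 → 3 := by
    rintro ⟨K, hK, -, hb⟩ m a x
    refine KoopmanRKHS.dissipative_of_norm_sum_le hX hk hd hφ a x fun t => ?_
    have : ∑ i, a i • KoopmanRKHS.kerSec H (φ t (x i)) =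
        K t (∑ i, a i • KoopmanRKHS.kerSec H (x i)) := by
      simp [hK]
    rw [this]
    exact (K t).le_of_opNorm_le (hb t) _
  tfae_have 3 → 2 := by
    intro hdiss
    choose K hK hb using fun t : ℝ≥0 => KoopmanRKHS.exists_extension_of_norm_sum_le (H := H) (φ t)
      (Real.exp_pos (ω * t)).le fun m a x =>
        KoopmanRKHS.norm_sum_le_of_dissipative hX hk hd hφ hdiss t a x
    refine ⟨K, hK, ⟨?_, fun t s => ?_, ?_⟩, hb⟩
    -- Bounded operators agreeing on all kernel sections coincide, so the flow identities pass to
    -- `K`.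
    · exact KoopmanRKHS.ext_kerSec fun x => by simp [hK, hφ.zero]
    · exact KoopmanRKHS.ext_kerSec fun x => by simp [hK, hφ.add]
    · refine KoopmanRKHS.tendsto_apply_of_dense_span hb
        KoopmanRKHS.span_range_kerSec_topologicalClosure ?_
      rintro _ ⟨x, rfl⟩
      simp only [hK]
      exact ((KoopmanRKHS.continuous_kerSec hk hkC1.continuousOn).tendsto x).comp
        (hφ.tendsto_zero x)
  tfae_finish
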